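/- Let $d\ge 0$ be an integer and let $\mathcal P_2(\mathbb R^d)$ be the set of Borel probability measures on $\mathbb R^d$ with finite second moment. For $\mu,\nu\in\mathcal P_2(\mathbb R^d)$ let $\Pi(\mu,\nu)$ be the set of their couplings, and put $$\mathsf W_2(\mu,\nu)=\Big(\inf_{\pi\in\Pi(\mu,\nu)}\int \|x-y\|^2\,d\pi(x,y)\Big)^{1/2},$$ $$\mathsf{IGW}(\mu,\nu)=\Big(\inf_{\pi\in\Pi(\mu,\nu)}\iint \big|\langle x,x'\rangle-\langle y,y'\rangle\big|^2\,d\pi\otimes\pi(x,y,x',y')\Big)^{1/2}.$$ Let $\mathbf\Sigma_\mu=\int xx^{\intercal}\,d\mu(x)$ be the (uncentered) covariance matrix of $\mu$, and $\lambda_{\min}(\mathbf\Sigma_\mu)$ its smallest eigenvalue ($+\infty$ if $d=0$). **Proposition (Lipschitz IGW and Wasserstein curves).** Let $L\ge 0$ and $c>0$, and let $\rho:[0,1]\to\mathcal P_2(\mathbb R^d)$ satisfy $\mathsf{IGW}(\rho_s,\rho_t)\le L|s-t|$ for all $s,t\in[0,1]$ and $\inf_{t\in[0,1]}\lambda_{\min}(\mathbf\Sigma_{\rho_t})\ge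 c$. Then there is a curve $\tilde\rho:[0,1]\to\mathcal P_2(\mathbb R^d)$ such that 1. $\mathsf W_2(\tilde\rho_s,\tilde\rho_t)\le \frac{L}{\sqrt c}\,|s-t|$ for all $s,t\in[0,1]$; 2. $\sup_{t\in[0,1]}\mathsf{IGW}(\rho_t,\tilde\rho_t)=0$; 3. for every $t\in[0,1]$ there is an orthogonal transformation $\mathbf O_t\in\mathrm O(d)$ with $\tilde\rho_t=(\mathbf O_t)_\sharp\rho_t$. -/

import Mathlib

open MeasureTheory
open scoped ENNReal NNReal

noncomputable section

namespace IGWCurve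

/-- The Euclidean space `ℝ^d`. -/
abbrev Euc (d : ℕ) : Type := EuclideanSpace ℝ (Fin d)

/-- Borel probability measures on `ℝ^d` with finite second moment. -/
def P2 (d : ℕ) : Type :=
  {μ : Measure (Euc d) // IsProbabilityMeasure μ ∧ MemLp (fun x : Euc d => x) 2 μ}

/-- The couplings of `μ` and `ν`. -/
def couplings {d : ℕ} (μ ν : Measure (Euc d)) : Set (Measure (Euc d × Euc d)) :=
  {π | π.fst = μ ∧ π.snd = ν}

/-- The 2-Wasserstein distance, valued in `[0, ∞]`. -/
def W2 {d : ℕ} (μ ν : P2 d) : ℝ≥0∞ :=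
  (⨅ π ∈ couplings μ.1 ν.1, ∫⁻ z, ENNReal.ofReal (‖z.1 - z.2‖ ^ 2) ∂π) ^ (1 / 2 : ℝ)

/-- The inner product Gromov-Wasserstein distance, valued in `[0, ∞]`; the integration variable is
`z = ((x, y), (x', y'))`. -/
def IGW {d : ℕ} (μ ν : P2 d) : ℝ≥0∞ :=
  (⨅ π ∈ couplings μ.1 ν.1,
    ∫⁻ z : (Euc d × Euc d) × (Euc d × Euc d),
      ENNReal.ofReal (|inner ℝ z.1.1 z.2.1 - inner ℝ z.1.2 z.2.2| ^ 2) ∂(π.prod π)) ^ (1 / 2 : ℝ)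

/-- The (uncentered) covariance matrix `∫ x xᵀ dμ(x)`. -/
def covMatrix {d : ℕ} (μ : P2 d) : Matrix (Fin d) (Fin d) ℝ :=
  Matrix.of fun i j => ∫ x, x i * x j ∂μ.1

lemma covMatrix_isHermitian {d : ℕ} (μ : P2 d) : (covMatrix μ).IsHermitian := by
  ext i j
  simp [covMatrix, Matrix.conjTranspose_apply, mul_comm]

/-- The smallest eigenvalue of the covariance matrix, in the extended reals (so that it is `⊤`, the
infimum of the empty set, in dimension zero). -/
def lambdaMin {d : ℕ} (μ : P2 d) : EReal :=
  ⨅ i : Fin d, (((covMatrix_isHermitian μ).eigenvalues i : ℝ) : EReal)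

/-- The curve `γ : [0,1] → 𝒫₂(ℝ^d)` is `L`-Lipschitz with respect to the distance `D`. -/
def IsLipschitzCurve {d : ℕ} (D : P2 d → P2 d → ℝ≥0∞) (L : ℝ≥0) (γ : unitInterval → P2 d) : Prop :=
  ∀ s t : unitInterval, D (γ s) (γ t) ≤ ENNReal.ofReal (L * |(s : ℝ) - (t : ℝ)|)

end IGWCurve

end

/-! ### Scalar inequality and singular value decomposition -/

namespace IGWCurve

/-! The core is a static estimate: if both covariances are at least `c`, some rotation `O` gives `W2
μ (O ν) ≤ IGW μ ν / √c` (`exists_mem_isometries_W2_le`). For a coupling, diagonalise the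
cross-covariance by an SVD with bases `u`, `v` and let `O` send `v i` to `u i`. With `a i`, `b i`
the diagonal covariance entries and `s i ≥ 0` the singular values, the Wasserstein cost is `∑ (a i +
b i - 2 s i)`. The IGW cost is at least `∑ (a i ^ 2 + b i ^ 2 - 2 s i ^ 2)`, since its off-diagonal
terms are sums of squares. The two are compared index by index.

For the curve, rotations are chosen consistently on finite sets of times by composing from each time
to the next; the triangle inequality loses nothing because distances add along `[0,1]`. Compactness
of the product of copies of `O(d)` (Tychonoff) passes to all times, the constraints being closed
because `W2` is lower semicontinuous in the rotations. -/

lemma mul_add_sub_le_sq_add_sq_sub {a b c s : ℝ} (ha : c ≤ a) (hb : c ≤ b) (hs : 0 ≤ s)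
    (hab : 2 * s ≤ a + b) : c * (a + b - 2 * s) ≤ a ^ 2 + b ^ 2 - 2 * s ^ 2 := by
  -- From `a² + b² ≥ (a + b)² / 2`, the right side is at least `(a + b - 2s)(a + b + 2s) / 2`, and
  -- `a + b + 2s ≥ 2c`.
  have h : 0 ≤ (a + b - 2 * s) * ((a - c) + (b - c) + 2 * s) := mul_nonneg (by linarith) (by linarith)
  nlinarith [sq_nonneg (a - b)]

/-- A form of the singular value decomposition. -/
lemma exists_orthonormalBasis_inner_eq_zero {d : ℕ} (T : Euc d →ₗ[ℝ] Euc d) :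
    ∃ u v : OrthonormalBasis (Fin d) ℝ (Euc d),
      (∀ i j, i ≠ j → inner ℝ (T (v i)) (u j) = 0) ∧ ∀ i, 0 ≤ inner ℝ (T (v i)) (u i) := by
  have hsym : (LinearMap.adjoint T ∘ₗ T).IsSymmetric := T.isSymmetric_adjoint_mul_self
  have hd : Module.finrank ℝ (Euc d) = d := by simp
  set v := hsym.eigenvectorBasis hd with hv
  have horth : ∀ i j, i ≠ j → inner ℝ (T (v i)) (T (v j)) = 0 := fun i j hij => by
    have h : inner ℝ (v i) ((LinearMap.adjoint T ∘ₗ T) (v j)) = 0 := by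
      rw [hv, hsym.apply_eigenvectorBasis hd j, inner_smul_right, ← hv, v.inner_eq_zero hij, mul_zero]
    rwa [LinearMap.comp_apply, LinearMap.adjoint_inner_right] at h
  -- Only nonzero images can be normalised; the other vectors of `u` come from an arbitrary
  -- orthonormal completion.
  let s : Set (Fin d) := {i | T (v i) ≠ 0}
  let w : Fin d → Euc d := fun i => (‖T (v i)‖⁻¹ : ℝ) • T (v i)
  have hw : Orthonormal ℝ (s.domRestrict w) := by
    refine ⟨fun i => ?_, fun i j hij => ?_⟩
    · have : ‖T (v i)‖ ≠ 0 := norm_ne_zero_iff.2 i.2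
      simp [w, Set.domRestrict, norm_smul, this]
    · simp [w, Set.domRestrict, inner_smul_left, inner_smul_right,
        horth i j (fun h => hij (Subtype.ext h))]
  obtain ⟨u, hu⟩ := hw.exists_orthonormalBasis_extension_of_card_eq (by simp)
  have hTu : ∀ i, T (v i) = ‖T (v i)‖ • u i := fun i => by
    by_cases hi : T (v i) = 0
    · simp [hi]
    · rw [hu i hi]
      simp [w, smul_smul, norm_ne_zero_iff.2 hi]
  refine ⟨u, v, fun i j hij => ?_, fun i => ?_⟩
  · rw [hTu, inner_smul_left, u.inner_eq_zero hij, mul_zero]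
  · rw [hTu, inner_smul_left]
    simp

/-! ### Covariances under a coupling and the rotation estimate -/

section Coupling

variable {d : ℕ} {Ω : Type*} [MeasurableSpace Ω] {π : Measure Ω} {f g : Ω → Euc d}

lemma memLp_inner_const (hf : MemLp f 2 π) (u : Euc d) : MemLp (fun z => inner ℝ (f z) u) 2 π :=
  hf.inner_const u

lemma integrable_inner_mul_inner (hf : MemLp f 2 π) (hg : MemLp g 2 π) (u v : Euc d) :
    Integrable (fun z => inner ℝ (f z) u * inner ℝ (g z) v) π :=
  (memLp_inner_const hf u).integrable_mul (memLp_inner_const hg v)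

lemma exists_linearMap_inner_eq_integral (hf : MemLp f 2 π) (hg : MemLp g 2 π) :
    ∃ T : Euc d →ₗ[ℝ] Euc d, ∀ u v,
      inner ℝ (T v) u = ∫ z, inner ℝ (f z) u * inner ℝ (g z) v ∂π := by
  have hint : ∀ v, Integrable (fun z => (inner ℝ (g z) v : ℝ) • f z) π := fun v =>
    memLp_one_iff_integrable.1 (hf.smul (memLp_inner_const hg v))
  refine ⟨{ toFun := fun v => ∫ z, (inner ℝ (g z) v : ℝ) • f z ∂π
            map_add' := fun v w => ?_
            map_smul' := fun r v => ?_ }, fun u v => ?_⟩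
  · simp_rw [inner_add_right, add_smul]
    exact integral_add (hint v) (hint w)
  · simp_rw [inner_smul_right, mul_smul]
    exact integral_smul r _
  · simp only [LinearMap.coe_mk, AddHom.coe_mk]
    rw [real_inner_comm, ← integral_inner (hint v)]
    refine integral_congr_ae (.of_forall fun z => ?_)
    simp only [inner_smul_right, real_inner_comm u]
    ring

/-- The expansion of the squared inner product discrepancy in orthonormal coordinates. -/
lemma sq_inner_sub_inner_eq_sum (u v : OrthonormalBasis (Fin d) ℝ (Euc d)) (x x' y y' : Euc d) :
    |inner ℝ x x' - inner ℝ y y'| ^ 2 = ∑ i, ∑ j,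
      ((inner ℝ x (u i) * inner ℝ x (u j)) * (inner ℝ x' (u i) * inner ℝ x' (u j))
        - 2 * ((inner ℝ x (u i) * inner ℝ y (v j)) * (inner ℝ x' (u i) * inner ℝ y' (v j)))
        + (inner ℝ y (v i) * inner ℝ y (v j)) * (inner ℝ y' (v i) * inner ℝ y' (v j))) := by
  rw [sq_abs, ← u.sum_inner_mul_inner x x', ← v.sum_inner_mul_inner y y', sub_sq, sq, sq,
    mul_assoc 2, Finset.sum_mul_sum, Finset.sum_mul_sum, Finset.sum_mul_sum, Finset.mul_sum,
    ← Finset.sum_sub_distrib, ← Finset.sum_add_distrib]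
  refine Finset.sum_congr rfl fun i _ => ?_
  rw [Finset.mul_sum, ← Finset.sum_sub_distrib, ← Finset.sum_add_distrib]
  refine Finset.sum_congr rfl fun j _ => ?_
  simp only [real_inner_comm x' (u _), real_inner_comm y' (v _)]
  ring

/-- Each term of the expansion is one function evaluated at both independent copies, so Fubini turns
it into the square of a (cross-)covariance entry. -/
lemma integrable_and_integral_sq_inner_sub_inner [IsProbabilityMeasure π] (hf : MemLp f 2 π) (hg : MemLp g 2 π)
    (u v : OrthonormalBasis (Fin d) ℝ (Euc d)) :
    Integrable (fun z : Ω × Ω => |inner ℝ (f z.1) (f z.2) - inner ℝ (g z.1) (g z.2)| ^ 2)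
      (π.prod π) ∧
    ∫ z : Ω × Ω, |inner ℝ (f z.1) (f z.2) - inner ℝ (g z.1) (g z.2)| ^ 2 ∂(π.prod π) =
      ∑ i, ∑ j, ((∫ z, inner ℝ (f z) (u i) * inner ℝ (f z) (u j) ∂π) ^ 2
        - 2 * (∫ z, inner ℝ (f z) (u i) * inner ℝ (g z) (v j) ∂π) ^ 2
        + (∫ z, inner ℝ (g z) (v i) * inner ℝ (g z) (v j) ∂π) ^ 2) := by
  simp_rw [sq_inner_sub_inner_eq_sum u v]
  have h1 : ∀ i j, Integrable (fun z : Ω × Ω =>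
      (inner ℝ (f z.1) (u i) * inner ℝ (f z.1) (u j)) *
        (inner ℝ (f z.2) (u i) * inner ℝ (f z.2) (u j))) (π.prod π) := fun i j =>
    (integrable_inner_mul_inner hf hf (u i) (u j)).mul_prod
      (integrable_inner_mul_inner hf hf (u i) (u j))
  have h2 : ∀ i j, Integrable (fun z : Ω × Ω =>
      2 * ((inner ℝ (f z.1) (u i) * inner ℝ (g z.1) (v j)) *
        (inner ℝ (f z.2) (u i) * inner ℝ (g z.2) (v j)))) (π.prod π) := fun i j =>
    ((integrable_inner_mul_inner hf hg (u i) (v j)).mul_prod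
      (integrable_inner_mul_inner hf hg (u i) (v j))).const_mul 2
  have h3 : ∀ i j, Integrable (fun z : Ω × Ω =>
      (inner ℝ (g z.1) (v i) * inner ℝ (g z.1) (v j)) *
        (inner ℝ (g z.2) (v i) * inner ℝ (g z.2) (v j))) (π.prod π) := fun i j =>
    (integrable_inner_mul_inner hg hg (v i) (v j)).mul_prod
      (integrable_inner_mul_inner hg hg (v i) (v j))
  have h12 := fun i j => (h1 i j).sub (h2 i j)
  simp only [Pi.sub_def] at h12
  have h := fun i j => (h12 i j).add (h3 i j)
  simp only [Pi.add_def] at h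
  refine ⟨integrable_finsetSum _ fun i _ => integrable_finsetSum _ fun j _ => h i j, ?_⟩
  rw [integral_finsetSum _ fun i _ => integrable_finsetSum _ fun j _ => h i j]
  refine Finset.sum_congr rfl fun i _ => ?_
  rw [integral_finsetSum _ fun j _ => h i j]
  refine Finset.sum_congr rfl fun j _ => ?_
  rw [integral_add (h12 i j) (h3 i j), integral_sub (h1 i j) (h2 i j),
    integral_const_mul,
    integral_prod_mul (fun z => inner ℝ (f z) (u i) * inner ℝ (f z) (u j))
      (fun z => inner ℝ (f z) (u i) * inner ℝ (f z) (u j)),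
    integral_prod_mul (fun z => inner ℝ (f z) (u i) * inner ℝ (g z) (v j))
      (fun z => inner ℝ (f z) (u i) * inner ℝ (g z) (v j)),
    integral_prod_mul (fun z => inner ℝ (g z) (v i) * inner ℝ (g z) (v j))
      (fun z => inner ℝ (g z) (v i) * inner ℝ (g z) (v j))]
  ring

lemma integral_sq_norm_sub_equiv (hf : MemLp f 2 π) (hg : MemLp g 2 π)
    (u v : OrthonormalBasis (Fin d) ℝ (Euc d)) :
    ∫ z, ‖f z - v.equiv u (Equiv.refl _) (g z)‖ ^ 2 ∂π =
      ∑ i, ((∫ z, inner ℝ (f z) (u i) * inner ℝ (f z) (u i) ∂π)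
        + (∫ z, inner ℝ (g z) (v i) * inner ℝ (g z) (v i) ∂π)
        - 2 * ∫ z, inner ℝ (f z) (u i) * inner ℝ (g z) (v i) ∂π) := by
  have hO : ∀ y i, inner ℝ (v.equiv u (Equiv.refl _) y) (u i) = inner ℝ y (v i) := fun y i => by
    rw [show u i = v.equiv u (Equiv.refl _) (v i) by simp, LinearIsometryEquiv.inner_map_map]
  have key : ∀ z, ‖f z - v.equiv u (Equiv.refl _) (g z)‖ ^ 2 =
      ∑ i, (inner ℝ (f z) (u i) * inner ℝ (f z) (u i)
        + inner ℝ (g z) (v i) * inner ℝ (g z) (v i)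
        - 2 * (inner ℝ (f z) (u i) * inner ℝ (g z) (v i))) := fun z => by
    rw [← real_inner_self_eq_norm_sq, ← u.sum_inner_mul_inner]
    refine Finset.sum_congr rfl fun i _ => ?_
    rw [real_inner_comm (f z - _) (u i), inner_sub_left, hO]
    ring
  simp_rw [key]
  have h1 := fun i => integrable_inner_mul_inner hf hf (u i) (u i)
  have h2 := fun i => integrable_inner_mul_inner hg hg (v i) (v i)
  have h3 := fun i => (integrable_inner_mul_inner hf hg (u i) (v i)).const_mul 2
  have h12 := fun i => (h1 i).add (h2 i)
  simp only [Pi.add_def] at h12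
  have h := fun i => (h12 i).sub (h3 i)
  simp only [Pi.sub_def] at h
  rw [integral_finsetSum _ fun i _ => h i]
  refine Finset.sum_congr rfl fun i _ => ?_
  rw [integral_sub (h12 i) (h3 i), integral_add (h1 i) (h2 i), integral_const_mul]

/-- The quadratic Wasserstein cost of a coupling, after a suitable rotation, is controlled by its
inner product Gromov-Wasserstein cost as soon as both covariances are bounded below. -/
lemma exists_linearIsometryEquiv_mul_lintegral_le [IsProbabilityMeasure π] {c : ℝ} (hc : 0 ≤ c)
    (hf : MemLp f 2 π) (hg : MemLp g 2 π)
    (hcf : ∀ u : Euc d, ‖u‖ = 1 → c ≤ ∫ z, inner ℝ (f z) u * inner ℝ (f z) u ∂π)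
    (hcg : ∀ u : Euc d, ‖u‖ = 1 → c ≤ ∫ z, inner ℝ (g z) u * inner ℝ (g z) u ∂π) :
    ∃ O : Euc d ≃ₗᵢ[ℝ] Euc d,
      ENNReal.ofReal c * ∫⁻ z, ENNReal.ofReal (‖f z - O (g z)‖ ^ 2) ∂π ≤
        ∫⁻ z : Ω × Ω, ENNReal.ofReal
          (|inner ℝ (f z.1) (f z.2) - inner ℝ (g z.1) (g z.2)| ^ 2) ∂(π.prod π) := by
  obtain ⟨T, hT⟩ := exists_linearMap_inner_eq_integral hf hg
  obtain ⟨u, v, hoff, hdiag⟩ := exists_orthonormalBasis_inner_eq_zero T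
  obtain ⟨hint, heq⟩ := integrable_and_integral_sq_inner_sub_inner hf hg u v
  refine ⟨v.equiv u (Equiv.refl _), ?_⟩
  have hOg : MemLp (fun z => v.equiv u (Equiv.refl _) (g z)) 2 π :=
    (v.equiv u (Equiv.refl _)).toContinuousLinearEquiv.toContinuousLinearMap.comp_memLp' hg
  have hint' : Integrable (fun z => ‖f z - v.equiv u (Equiv.refl _) (g z)‖ ^ 2) π :=
    (hf.sub hOg).integrable_norm_pow two_ne_zero
  rw [← ofReal_integral_eq_lintegral_ofReal hint' (.of_forall fun z => by positivity),
    ← ofReal_integral_eq_lintegral_ofReal hint (.of_forall fun z => by positivity),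
    ← ENNReal.ofReal_mul hc]
  refine ENNReal.ofReal_le_ofReal ?_
  rw [heq, integral_sq_norm_sub_equiv hf hg, Finset.mul_sum]
  refine Finset.sum_le_sum fun i _ => ?_
  have hAM : 2 * (∫ z, inner ℝ (f z) (u i) * inner ℝ (g z) (v i) ∂π) ≤
      (∫ z, inner ℝ (f z) (u i) * inner ℝ (f z) (u i) ∂π)
        + ∫ z, inner ℝ (g z) (v i) * inner ℝ (g z) (v i) ∂π := by
    rw [← integral_const_mul, ← integral_add (integrable_inner_mul_inner hf hf _ _)
      (integrable_inner_mul_inner hg hg _ _)]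
    refine integral_mono ((integrable_inner_mul_inner hf hg _ _).const_mul 2)
      ((integrable_inner_mul_inner hf hf _ _).add (integrable_inner_mul_inner hg hg _ _))
      fun z => ?_
    dsimp only
    nlinarith [sq_nonneg (inner ℝ (f z) (u i) - inner ℝ (g z) (v i) : ℝ)]
  refine (mul_add_sub_le_sq_add_sq_sub (hcf _ (u.norm_eq_one i)) (hcg _ (v.norm_eq_one i))
    (by rw [← hT]; exact hdiag i) hAM).trans ?_
  -- Keep only the diagonal term `j = i` of row `i`; the discarded terms are nonnegative because the
  -- cross-covariance vanishes off the diagonal.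
  refine le_trans (le_of_eq ?_) (Finset.single_le_sum (fun j _ => ?_) (Finset.mem_univ i))
  · ring
  · rcases eq_or_ne j i with rfl | hji
    · have h1 := hcf _ (u.norm_eq_one j)
      have h2 := hcg _ (v.norm_eq_one j)
      have h3 := hdiag j
      rw [hT] at h3
      nlinarith [mul_add_sub_le_sq_add_sq_sub h1 h2 h3 hAM, mul_nonneg hc (sub_nonneg.2 hAM)]
    · rw [← hT, hoff j i hji]
      simp only [ne_eq, OfNat.ofNat_ne_zero, not_false_eq_true, zero_pow, mul_zero, sub_zero]
      positivity

end Coupling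

/-! ### Gluing and the Wasserstein triangle inequality -/

variable {d : ℕ}

instance (μ : P2 d) : IsProbabilityMeasure μ.1 := μ.2.1

lemma isProbabilityMeasure_of_mem_couplings {μ ν : P2 d} {π : Measure (Euc d × Euc d)}
    (hπ : π ∈ couplings μ.1 ν.1) : IsProbabilityMeasure π := by
  refine ⟨?_⟩
  rw [← Measure.fst_univ, hπ.1]
  exact measure_univ

/-- Two measures with a common marginal can be glued along it. -/
lemma exists_gluing {α β γ : Type*} [MeasurableSpace α] [MeasurableSpace β] [MeasurableSpace γ]
    [StandardBorelSpace γ] [Nonempty γ] (π : Measure (α × β)) (π' : Measure (β × γ))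
    [IsFiniteMeasure π] [IsFiniteMeasure π'] (h : π.snd = π'.fst) :
    ∃ η : Measure ((α × β) × γ), η.fst = π ∧ η.map (fun w => (w.1.2, w.2)) = π' := by
  -- The third coordinate is drawn from the disintegration of `π'`, given only the shared middle
  -- one.
  refine ⟨π.compProd (π'.condKernel.comap Prod.snd measurable_snd), Measure.fst_compProd _ _, ?_⟩
  ext s hs
  have hm : Measurable fun w : (α × β) × γ => (w.1.2, w.2) := by fun_prop
  rw [Measure.map_apply hm hs, Measure.compProd_apply (hm hs)]
  conv_rhs => rw [← π'.disintegrate π'.condKernel, Measure.compProd_apply hs, ← h, Measure.snd,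
    lintegral_map (ProbabilityTheory.Kernel.measurable_kernel_prodMk_left hs) measurable_snd]
  rfl

/-- In `L²`-norm form, the triangle inequality reduces to gluing and Minkowski. -/
lemma W2_eq_iInf (μ ν : P2 d) :
    W2 μ ν = ⨅ π ∈ couplings μ.1 ν.1, eLpNorm (fun z : Euc d × Euc d => z.1 - z.2) 2 π := by
  have h : ∀ π : Measure (Euc d × Euc d), eLpNorm (fun z : Euc d × Euc d => z.1 - z.2) 2 π =
      (∫⁻ z, ENNReal.ofReal (‖z.1 - z.2‖ ^ 2) ∂π) ^ (1 / 2 : ℝ) := fun π => by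
    rw [eLpNorm_eq_lintegral_rpow_enorm_toReal two_ne_zero ENNReal.ofNat_ne_top]
    simp [ENNReal.ofReal_pow]
  simp_rw [h]
  exact ((ENNReal.orderIsoRpow (1 / 2 : ℝ) (by norm_num)).map_iInf _).trans
    (iInf_congr fun π => (ENNReal.orderIsoRpow (1 / 2 : ℝ) (by norm_num)).map_iInf _)

lemma W2_le {μ ν : P2 d} {π : Measure (Euc d × Euc d)} (hπ : π ∈ couplings μ.1 ν.1) :
    W2 μ ν ≤ eLpNorm (fun z : Euc d × Euc d => z.1 - z.2) 2 π := by
  rw [W2_eq_iInf]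
  exact iInf₂_le π hπ

lemma W2_triangle (μ ν κ : P2 d) : W2 μ κ ≤ W2 μ ν + W2 ν κ := by
  rw [W2_eq_iInf μ ν, W2_eq_iInf ν κ]
  simp_rw [ENNReal.iInf_add, ENNReal.add_iInf]
  refine le_iInf₂ fun π hπ => le_iInf₂ fun π' hπ' => ?_
  have := isProbabilityMeasure_of_mem_couplings hπ
  have := isProbabilityMeasure_of_mem_couplings hπ'
  obtain ⟨η, h1, h2⟩ := exists_gluing π π' (hπ.2.trans hπ'.1.symm)
  have hm : Measurable fun w : (Euc d × Euc d) × Euc d => (w.1.1, w.2) := by fun_prop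
  have hm' : Measurable fun w : (Euc d × Euc d) × Euc d => (w.1.2, w.2) := by fun_prop
  have hc : η.map (fun w => (w.1.1, w.2)) ∈ couplings μ.1 κ.1 := by
    constructor
    · rw [Measure.fst, Measure.map_map measurable_fst hm, ← hπ.1, ← h1, Measure.fst, Measure.fst,
        Measure.map_map measurable_fst measurable_fst]
      rfl
    · rw [Measure.snd, Measure.map_map measurable_snd hm, ← hπ'.2, ← h2, Measure.snd,
        Measure.map_map measurable_snd hm']
      rfl
  have hsub : StronglyMeasurable fun z : Euc d × Euc d => z.1 - z.2 :=
    (by fun_prop : Continuous fun z : Euc d × Euc d => z.1 - z.2).stronglyMeasurable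
  refine (W2_le hc).trans ?_
  rw [eLpNorm_map_measure hsub.aestronglyMeasurable hm.aemeasurable, ← h1, ← h2, Measure.fst,
    eLpNorm_map_measure hsub.aestronglyMeasurable hm'.aemeasurable,
    eLpNorm_map_measure hsub.aestronglyMeasurable measurable_fst.aemeasurable]
  refine le_trans (le_of_eq ?_) (eLpNorm_add_le
    (hsub.comp_measurable measurable_fst).aestronglyMeasurable
    (hsub.comp_measurable hm').aestronglyMeasurable one_le_two)
  congr 1
  ext1 w
  simp

/-! ### Push-forwards and semicontinuity -/

/-- The push-forward of a measure by a continuous linear map. -/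
noncomputable def push (A : Euc d →L[ℝ] Euc d) (μ : P2 d) : P2 d :=
  ⟨μ.1.map A, Measure.isProbabilityMeasure_map A.continuous.aemeasurable,
    (memLp_map_measure_iff (by fun_prop) A.continuous.aemeasurable).2 (A.comp_memLp' μ.2.2)⟩

lemma push_val (A : Euc d →L[ℝ] Euc d) (μ : P2 d) : (push A μ).1 = μ.1.map A := rfl

lemma push_comp (A B : Euc d →L[ℝ] Euc d) (μ : P2 d) : push (A ∘L B) μ = push A (push B μ) := by
  refine Subtype.ext ?_
  simp only [push]
  rw [Measure.map_map A.continuous.measurable B.continuous.measurable]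
  rfl

lemma push_id (μ : P2 d) : push (ContinuousLinearMap.id ℝ (Euc d)) μ = μ :=
  Subtype.ext Measure.map_id

lemma map_prodMk_mem_couplings (A B : Euc d →L[ℝ] Euc d) (μ : P2 d) :
    μ.1.map (fun x => (A x, B x)) ∈ couplings (push A μ).1 (push B μ).1 :=
  ⟨Measure.fst_map_prodMk B.continuous.measurable, Measure.snd_map_prodMk A.continuous.measurable⟩

lemma W2_push_push_le (A B : Euc d →L[ℝ] Euc d) (μ : P2 d) :
    W2 (push A μ) (push B μ) ≤ ‖A - B‖ₑ * eLpNorm (fun x : Euc d => x) 2 μ.1 := by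
  refine (W2_le (map_prodMk_mem_couplings A B μ)).trans ?_
  rw [eLpNorm_map_measure (by fun_prop) (by fun_prop)]
  exact eLpNorm_le_nnreal_smul_eLpNorm_of_ae_le_mul (f := fun x => A x - B x)
    (.of_forall fun x => (A - B).le_opNNNorm x) 2

lemma W2_push_le_of_norm_map {O : Euc d →L[ℝ] Euc d} (hO : ∀ x, ‖O x‖ = ‖x‖) (μ ν : P2 d) :
    W2 (push O μ) (push O ν) ≤ W2 μ ν := by
  rw [W2_eq_iInf μ ν]
  refine le_iInf₂ fun π hπ => ?_
  have hm : Measurable fun z : Euc d × Euc d => (O z.1, O z.2) := by fun_prop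
  have hc : π.map (fun z => (O z.1, O z.2)) ∈ couplings (push O μ).1 (push O ν).1 := by
    constructor
    · rw [Measure.fst, Measure.map_map measurable_fst hm, push_val, ← hπ.1, Measure.fst,
        Measure.map_map O.continuous.measurable measurable_fst]
      rfl
    · rw [Measure.snd, Measure.map_map measurable_snd hm, push_val, ← hπ.2, Measure.snd,
        Measure.map_map O.continuous.measurable measurable_snd]
      rfl
  refine (W2_le hc).trans ?_
  rw [eLpNorm_map_measure (by fun_prop) hm.aemeasurable]
  refine (eLpNorm_congr_norm_ae (.of_forall fun z => ?_)).le
  simp [← map_sub, hO]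

/-- Moving the maps changes `W2` by at most operator norm times second moment, through the triangle
inequality. -/
lemma lowerSemicontinuous_W2_push (μ ν : P2 d) :
    LowerSemicontinuous fun p : (Euc d →L[ℝ] Euc d) × (Euc d →L[ℝ] Euc d) =>
      W2 (push p.1 μ) (push p.2 ν) := by
  intro p y hy
  have hcont : Continuous fun q : (Euc d →L[ℝ] Euc d) × (Euc d →L[ℝ] Euc d) =>
      ‖p.1 - q.1‖ₑ * eLpNorm (fun x : Euc d => x) 2 μ.1 +
        ‖q.2 - p.2‖ₑ * eLpNorm (fun x : Euc d => x) 2 ν.1 :=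
    ((ENNReal.continuous_mul_const μ.2.2.2.ne).comp (by fun_prop)).add
      ((ENNReal.continuous_mul_const ν.2.2.2.ne).comp (by fun_prop))
  have h0 : ‖(0 : Euc d →L[ℝ] Euc d)‖ₑ = 0 := by
    rw [← ofReal_norm, norm_zero, ENNReal.ofReal_zero]
  -- The subtracted error tends to `0`, so finiteness of `W2` is not needed.
  have hlim := ENNReal.Tendsto.sub (tendsto_const_nhds (x := W2 (push p.1 μ) (push p.2 ν)))
    (hcont.tendsto p) (Or.inr (by simp only [sub_self, h0]; simp))
  simp only [sub_self, h0, zero_mul, add_zero, tsub_zero] at hlim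
  filter_upwards [hlim.eventually (lt_mem_nhds hy)] with q hq
  refine hq.trans_le (tsub_le_iff_right.2 ?_)
  calc W2 (push p.1 μ) (push p.2 ν)
      ≤ W2 (push p.1 μ) (push q.1 μ) + (W2 (push q.1 μ) (push q.2 ν)
          + W2 (push q.2 ν) (push p.2 ν)) :=
        (W2_triangle _ _ _).trans (add_le_add_right (W2_triangle _ _ _) _)
    _ ≤ _ := by
        rw [add_left_comm]
        gcongr <;> exact W2_push_push_le _ _ _

/-! ### The compact group of rotations and the static estimate -/

variable (d) in
/-- The linear isometries of `ℝ^d`, as a set of continuous linear maps. -/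
def isometries : Set (Euc d →L[ℝ] Euc d) := {O | ∀ x, ‖O x‖ = ‖x‖}

lemma isCompact_isometries : IsCompact (isometries d) := by
  refine Metric.isCompact_of_isClosed_isBounded ?_ ?_
  · simp only [isometries, Set.ofPred_forall]
    exact isClosed_iInter fun x => isClosed_eq (by fun_prop) continuous_const
  · refine isBounded_iff_forall_norm_le.2 ⟨1, fun O hO => ?_⟩
    exact O.opNorm_le_bound zero_le_one fun x => by rw [hO x, one_mul]

lemma comp_mem_isometries {A B : Euc d →L[ℝ] Euc d} (hA : A ∈ isometries d)
    (hB : B ∈ isometries d) : A ∘L B ∈ isometries d := fun x => (hA (B x)).trans (hB x)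

lemma id_mem_isometries : ContinuousLinearMap.id ℝ (Euc d) ∈ isometries d := fun _ => rfl

lemma exists_linearIsometryEquiv_of_mem_isometries {A : Euc d →L[ℝ] Euc d}
    (hA : A ∈ isometries d) : ∃ O : Euc d ≃ₗᵢ[ℝ] Euc d, ⇑O = A :=
  ⟨LinearIsometry.toLinearIsometryEquiv ⟨A.toLinearMap, hA⟩ rfl, rfl⟩

lemma IGW_push_eq_zero {O : Euc d →L[ℝ] Euc d} (hO : O ∈ isometries d) (μ : P2 d) :
    IGW μ (push O μ) = 0 := by
  have hc := map_prodMk_mem_couplings (ContinuousLinearMap.id ℝ _) O μ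
  rw [push_id] at hc
  have hinner : ∀ x y, inner ℝ (O x) (O y) = inner ℝ x y :=
    LinearIsometry.inner_map_map (⟨O.toLinearMap, hO⟩ : Euc d →ₗᵢ[ℝ] Euc d)
  have hm : Measurable fun x : Euc d => (x, O x) := by fun_prop
  rw [IGW, ENNReal.rpow_eq_zero_iff]
  refine Or.inl ⟨le_antisymm ((iInf₂_le _ hc).trans ?_) bot_le, by norm_num⟩
  simp only [ContinuousLinearMap.id_apply]
  rw [Measure.map_prod_map _ _ hm hm, lintegral_map (by fun_prop) (by fun_prop)]
  simp [hinner]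

/-- The integral is the quadratic form of the covariance operator `T`, which is diagonal in the
eigenbasis of `covMatrix μ`. -/
lemma le_integral_inner_mul_inner {μ : P2 d} {c : ℝ} (hμ : (c : EReal) ≤ lambdaMin μ)
    {u : Euc d} (hu : ‖u‖ = 1) : c ≤ ∫ x, inner ℝ x u * inner ℝ x u ∂μ.1 := by
  obtain ⟨T, hT⟩ := exists_linearMap_inner_eq_integral μ.2.2 μ.2.2
  set hH := covMatrix_isHermitian μ
  have hb : ∀ k, T (hH.eigenvectorBasis k) = hH.eigenvalues k • hH.eigenvectorBasis k := by
    intro k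
    ext i
    have h := congrFun (hH.mulVec_eigenvectorBasis k) i
    simp only [Pi.smul_apply] at h
    rw [PiLp.smul_apply, ← h, Matrix.mulVec, dotProduct]
    have h1 : T (hH.eigenvectorBasis k) i =
        inner ℝ (T (hH.eigenvectorBasis k)) (EuclideanSpace.single i (1 : ℝ)) := by
      simp [EuclideanSpace.inner_single_right]
    have h2 : ∀ x : Euc d, inner ℝ x (EuclideanSpace.single i (1 : ℝ)) *
        inner ℝ x (hH.eigenvectorBasis k) = ∑ j, x i * x j * hH.eigenvectorBasis k j := by
      intro x
      rw [EuclideanSpace.inner_single_right, PiLp.inner_apply, Finset.mul_sum]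
      refine Finset.sum_congr rfl fun j _ => ?_
      simp
      ring
    have h3 : ∀ j, Integrable (fun x : Euc d => x i * x j) μ.1 := fun j => by
      simpa [EuclideanSpace.inner_single_right] using integrable_inner_mul_inner μ.2.2 μ.2.2
        (EuclideanSpace.single i (1 : ℝ)) (EuclideanSpace.single j (1 : ℝ))
    rw [h1, hT]
    simp_rw [h2]
    rw [integral_finsetSum _ fun j _ => (h3 j).mul_const _]
    refine Finset.sum_congr rfl fun j _ => ?_
    rw [integral_mul_const]
    rfl
  have hsymm : ∀ v w, inner ℝ (T v) w = inner ℝ (T w) v := fun v w => by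
    simp_rw [hT, mul_comm]
  have hc : ∀ k, c ≤ hH.eigenvalues k := fun k =>
    EReal.coe_le_coe_iff.1 (hμ.trans (iInf_le _ k))
  rw [← hT, ← hH.eigenvectorBasis.sum_inner_mul_inner]
  calc c = ∑ k, c * (inner ℝ u (hH.eigenvectorBasis k) * inner ℝ (hH.eigenvectorBasis k) u) := by
        rw [← Finset.mul_sum, OrthonormalBasis.sum_inner_mul_inner, real_inner_self_eq_norm_sq, hu]
        simp
    _ ≤ _ := Finset.sum_le_sum fun k _ => by
        rw [hsymm, hb, inner_smul_left, real_inner_comm u]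
        simp only [RCLike.conj_to_real, mul_assoc]
        exact mul_le_mul_of_nonneg_right (hc k) (mul_self_nonneg _)

/-- Wasserstein-optimal rotations are controlled by the inner product Gromov-Wasserstein distance. -/
lemma exists_mem_isometries_W2_le {c : ℝ≥0} (hc : 0 < c) {μ ν : P2 d}
    (hμ : ((c : ℝ) : EReal) ≤ lambdaMin μ) (hν : ((c : ℝ) : EReal) ≤ lambdaMin ν) :
    ∃ O ∈ isometries d, W2 μ (push O ν) ≤ IGW μ ν / (NNReal.sqrt c : ℝ≥0∞) := by
  have hlsc : LowerSemicontinuous fun O => W2 μ (push O ν) := by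
    have h := (lowerSemicontinuous_W2_push μ ν).comp
      (g := fun O => (ContinuousLinearMap.id ℝ (Euc d), O)) (by fun_prop)
    simpa only [Function.comp_def, push_id] using h
  -- The rotation from the coupling estimate depends on the coupling. A minimiser over all rotations
  -- does at least as well for every coupling, so no optimal IGW coupling is needed.
  obtain ⟨O, hO, hmin⟩ := LowerSemicontinuousOn.exists_isMinOn ⟨_, id_mem_isometries⟩
    isCompact_isometries (hlsc.lowerSemicontinuousOn _)
  refine ⟨O, hO, ?_⟩
  have hc0 : (NNReal.sqrt c : ℝ≥0∞) ≠ 0 := by simpa using hc.ne'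
  rw [ENNReal.le_div_iff_mul_le (Or.inl hc0) (Or.inl ENNReal.coe_ne_top), IGW,
    one_div, ENNReal.le_rpow_inv_iff two_pos]
  refine le_iInf₂ fun π hπ => ?_
  have := isProbabilityMeasure_of_mem_couplings hπ
  have hfst : MeasurePreserving Prod.fst π μ.1 := ⟨measurable_fst, hπ.1⟩
  have hsnd : MeasurePreserving Prod.snd π ν.1 := ⟨measurable_snd, hπ.2⟩
  have hf : MemLp (Prod.fst : Euc d × Euc d → Euc d) 2 π := μ.2.2.comp_measurePreserving hfst
  have hg : MemLp (Prod.snd : Euc d × Euc d → Euc d) 2 π := ν.2.2.comp_measurePreserving hsnd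
  obtain ⟨R, hR⟩ := exists_linearIsometryEquiv_mul_lintegral_le c.2 hf hg
    (fun u hu => by
      have h := le_integral_inner_mul_inner hμ hu
      rwa [← hfst.map_eq, integral_map (by fun_prop) (by fun_prop)] at h)
    (fun u hu => by
      have h := le_integral_inner_mul_inner hν hu
      rwa [← hsnd.map_eq, integral_map (by fun_prop) (by fun_prop)] at h)
  refine le_trans ?_ hR
  have hRm : (R : Euc d →L[ℝ] Euc d) ∈ isometries d := R.norm_map
  have hm : Measurable fun z : Euc d × Euc d => (z.1, R z.2) := by fun_prop
  have hcR : π.map (fun z => (z.1, R z.2)) ∈ couplings μ.1 (push (R : Euc d →L[ℝ] Euc d) ν).1 := by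
    constructor
    · rw [Measure.fst, Measure.map_map measurable_fst hm, ← hπ.1]
      rfl
    · rw [Measure.snd, Measure.map_map measurable_snd hm, push_val, ← hπ.2, Measure.snd,
        Measure.map_map (by fun_prop) measurable_snd]
      rfl
  have hW : W2 μ (push O ν) ^ (2 : ℝ) ≤ ∫⁻ z, ENNReal.ofReal (‖z.1 - R z.2‖ ^ 2) ∂π := by
    rw [← ENNReal.le_rpow_inv_iff two_pos, ← one_div]
    refine (hmin hRm).trans ?_
    refine ENNReal.rpow_le_rpow ((iInf₂_le _ hcR).trans ?_) (by norm_num)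
    rw [lintegral_map (by fun_prop) hm]
  rw [ENNReal.mul_rpow_of_nonneg _ _ two_pos.le, mul_comm]
  refine mul_le_mul' (le_of_eq ?_) hW
  rw [ENNReal.rpow_two, ← ENNReal.coe_pow, NNReal.sq_sqrt]
  simp

/-! ### Choosing the rotations along the curve -/

lemma W2_comm_le (μ ν : P2 d) : W2 ν μ ≤ W2 μ ν := by
  rw [W2_eq_iInf μ ν]
  refine le_iInf₂ fun π hπ => ?_
  have hc : π.map Prod.swap ∈ couplings ν.1 μ.1 :=
    ⟨Measure.fst_map_swap.trans hπ.2, Measure.snd_map_swap.trans hπ.1⟩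
  refine (W2_le hc).trans ?_
  rw [eLpNorm_map_measure (by fun_prop) (by fun_prop)]
  refine (eLpNorm_congr_norm_ae (.of_forall fun z => ?_)).le
  exact norm_sub_rev _ _

lemma W2_self (μ : P2 d) : W2 μ μ = 0 := by
  have h := map_prodMk_mem_couplings (ContinuousLinearMap.id ℝ _) (ContinuousLinearMap.id ℝ _) μ
  rw [push_id] at h
  refine le_antisymm ((W2_le h).trans ?_) bot_le
  rw [eLpNorm_map_measure (by fun_prop) (by fun_prop)]
  simp [Function.comp_def]

/-- Finitely many rotations can be chosen one after the other, in increasing order of the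
parameter. -/
lemma exists_isometries_W2_le_of_finset {ρ : unitInterval → P2 d} {K : ℝ}
    (hK : 0 ≤ K) (h : ∀ s t : unitInterval, ∃ O ∈ isometries d,
      W2 (ρ s) (push O (ρ t)) ≤ ENNReal.ofReal (K * |(s : ℝ) - t|)) (F : Finset unitInterval) :
    ∃ O : unitInterval → Euc d →L[ℝ] Euc d, (∀ t, O t ∈ isometries d) ∧
      ∀ s ∈ F, ∀ t ∈ F, s < t →
        W2 (push (O s) (ρ s)) (push (O t) (ρ t)) ≤ ENNReal.ofReal (K * |(s : ℝ) - t|) := by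
  induction F using Finset.induction_on_max with
  | empty => exact ⟨fun _ => ContinuousLinearMap.id ℝ _, fun _ => id_mem_isometries, by simp⟩
  | insert a F hF ih =>
    obtain ⟨O, hO, hOF⟩ := ih
    rcases F.eq_empty_or_nonempty with rfl | hne
    · refine ⟨O, hO, fun s hs t ht hst => ?_⟩
      simp only [insert_empty_eq, Finset.mem_singleton] at hs ht
      exact absurd (hs.trans ht.symm) hst.ne
    have hm := F.max'_mem hne
    set m := F.max' hne
    -- The new time `a` is compared only with its predecessor `m`; earlier times reach it through
    -- `m`, with `|s - m| + |m - a| = |s - a|`.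
    obtain ⟨P, hP, hPW⟩ := h m a
    have hupd : ∀ s ∈ F, Function.update O a (O m ∘L P) s = O s := fun s hs =>
      Function.update_of_ne (hF s hs).ne _ _
    have hma : W2 (push (O m) (ρ m)) (push (O m ∘L P) (ρ a)) ≤
        ENNReal.ofReal (K * |(m : ℝ) - a|) := by
      rw [push_comp]
      exact (W2_push_le_of_norm_map (hO m) _ _).trans hPW
    refine ⟨Function.update O a (O m ∘L P), fun t => ?_, fun s hs t ht hst => ?_⟩
    · rcases eq_or_ne t a with rfl | hta
      · rw [Function.update_self]
        exact comp_mem_isometries (hO m) hP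
      · rw [Function.update_of_ne hta]
        exact hO t
    rcases Finset.mem_insert.1 ht with rfl | htF
    · rcases Finset.mem_insert.1 hs with rfl | hsF
      · exact absurd hst (lt_irrefl _)
      rw [hupd s hsF, Function.update_self]
      rcases (F.le_max' s hsF).eq_or_lt with hsm | hsm
      · rw [hsm]
        exact hma
      have hsm' : (s : ℝ) < m := hsm
      have hmt : (m : ℝ) < t := hF m hm
      refine (W2_triangle _ (push (O m) (ρ m)) _).trans
        ((add_le_add (hOF s hsF m hm hsm) hma).trans (le_of_eq ?_))
      rw [← ENNReal.ofReal_add (by positivity) (by positivity), abs_of_neg (by linarith),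
        abs_of_neg (by linarith), abs_of_neg (by linarith)]
      ring_nf
    · rcases Finset.mem_insert.1 hs with rfl | hsF
      · exact absurd hst (hF t htF).not_gt
      rw [hupd s hsF, hupd t htF]
      exact hOF s hsF t htF hst

lemma exists_isometries_W2_le {ρ : unitInterval → P2 d} {K : ℝ}
    (hK : 0 ≤ K) (h : ∀ s t : unitInterval, ∃ O ∈ isometries d,
      W2 (ρ s) (push O (ρ t)) ≤ ENNReal.ofReal (K * |(s : ℝ) - t|)) :
    ∃ O : unitInterval → Euc d →L[ℝ] Euc d, (∀ t, O t ∈ isometries d) ∧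
      ∀ s t, W2 (push (O s) (ρ s)) (push (O t) (ρ t)) ≤ ENNReal.ofReal (K * |(s : ℝ) - t|) := by
  let C : unitInterval × unitInterval → Set (unitInterval → Euc d →L[ℝ] Euc d) := fun p =>
    {O | p.1 < p.2 → W2 (push (O p.1) (ρ p.1)) (push (O p.2) (ρ p.2)) ≤
      ENNReal.ofReal (K * |(p.1 : ℝ) - p.2|)}
  have hC : ∀ p, IsClosed (C p) := fun p => by
    by_cases hp : p.1 < p.2
    · simp only [C, hp, forall_const]
      exact ((lowerSemicontinuous_W2_push (ρ p.1) (ρ p.2)).comp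
        (g := fun O : unitInterval → Euc d →L[ℝ] Euc d => (O p.1, O p.2))
        (by fun_prop)).isClosed_preimage _
    · simp [C, hp]
  -- Finite intersection property: finitely many constraints involve finitely many times.
  obtain ⟨O, hO, hOC⟩ := (isCompact_univ_pi fun _ : unitInterval =>
    isCompact_isometries (d := d)).inter_iInter_nonempty C hC fun u => by
      classical
      obtain ⟨O, hO, hOF⟩ := exists_isometries_W2_le_of_finset hK h
        (u.image Prod.fst ∪ u.image Prod.snd)
      refine ⟨O, fun t _ => hO t, Set.mem_iInter₂.2 fun p hp => ?_⟩
      exact hOF p.1 (Finset.mem_union_left _ (Finset.mem_image_of_mem _ hp)) p.2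
        (Finset.mem_union_right _ (Finset.mem_image_of_mem _ hp))
  have hlt : ∀ s t, s < t → W2 (push (O s) (ρ s)) (push (O t) (ρ t)) ≤
      ENNReal.ofReal (K * |(s : ℝ) - t|) := fun s t => Set.mem_iInter.1 hOC (s, t)
  refine ⟨O, fun t => hO t trivial, fun s t => ?_⟩
  rcases lt_trichotomy s t with hst | rfl | hst
  · exact hlt s t hst
  · rw [W2_self]
    exact zero_le
  · rw [abs_sub_comm]
    exact (W2_comm_le _ _).trans (hlt t s hst)

end IGWCurve

open IGWCurve in
theorem mainTheorem9 (d : ℕ) (L c : ℝ≥0) (hc : 0 < c) (ρ : unitInterval → IGWCurve.P2 d)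
    (hρ : IGWCurve.IsLipschitzCurve IGWCurve.IGW L ρ)
    (hcov : ((c : ℝ) : EReal) ≤ ⨅ t : unitInterval, IGWCurve.lambdaMin (ρ t)) :
    ∃ ρ' : unitInterval → IGWCurve.P2 d,
      IGWCurve.IsLipschitzCurve IGWCurve.W2 (L / NNReal.sqrt c) ρ' ∧
      (⨆ t : unitInterval, IGWCurve.IGW (ρ t) (ρ' t)) = 0 ∧
      ∀ t : unitInterval, ∃ O : IGWCurve.Euc d ≃ₗᵢ[ℝ] IGWCurve.Euc d,
        (ρ' t).1 = (ρ t).1.map O := by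
  have hc' : 0 < NNReal.sqrt c := NNReal.sqrt_pos.2 hc
  have hcov' : ∀ t, ((c : ℝ) : EReal) ≤ lambdaMin (ρ t) := fun t => hcov.trans (iInf_le _ t)
  obtain ⟨O, hO, hW⟩ := exists_isometries_W2_le (ρ := ρ) (K := (L / NNReal.sqrt c : ℝ≥0))
    (NNReal.coe_nonneg _) fun s t => by
      obtain ⟨O, hO, h⟩ := exists_mem_isometries_W2_le hc (hcov' s) (hcov' t)
      refine ⟨O, hO, h.trans ((ENNReal.div_le_div_right (hρ s t) _).trans (le_of_eq ?_))⟩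
      rw [← ENNReal.ofReal_coe_nnreal, ← ENNReal.ofReal_div_of_pos (NNReal.coe_pos.2 hc'),
        NNReal.coe_div, div_mul_eq_mul_div]
  refine ⟨fun t => push (O t) (ρ t), hW, ?_, fun t => ?_⟩
  · simp only [IGW_push_eq_zero (hO _), iSup_const]
  · obtain ⟨R, hR⟩ := exists_linearIsometryEquiv_of_mem_isometries (hO t)
    exact ⟨R, by rw [hR, push_val]⟩
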